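/- Let $d\ge 1$ and $J\ge 1$ be integers. For $E=\mathbb R^d$, $E=\mathbb R^d\times\mathbb R^d$ or $E=(\mathbb R^d)^J$, let $GMM(E)$ be the set of finite Gaussian mixtures on $E$, i.e. of the probability measures $\sum_{k=1}^K \pi_k g_k$ with $K\ge 1$, $\pi_k\ge 0$, $\sum_k\pi_k=1$ and $g_1,\dots,g_K$ Gaussian measures on $E$ (degenerate covariances allowed). For $\mu,\nu\in GMM(\mathbb R^d)$ put $$MW_2^2(\mu,\nu)=\inf_{\gamma}\int_{\mathbb R^d\times\mathbb R^d}\|y_0-y_1\|^2\,d\gamma(y_0,y_1),$$ where the infimum is over all $\gamma\in GMM(\mathbb R^d\times\mathbb R^d)$ with marginals $\mu$ and $\nu$. Let $\mu_0,\dots,\mu_{J-1}\in GMM(\mathbb R^d)$, and let $\lambda_0,\dots,\lambda_{J-1}\ge 0$ with $\sum_j\lambda_j=1$. For $x=(x_0,\dots,x_{J-1})\in(\mathbb R^d)^J$ let $B(x)=\sum_{j=0}^{J-1}\lambda_j x_j$, and set $$MMW_2^2(\mu_0,\dots,\mu_{J-1})=\inf_{\gamma}\int_{(\mathbb R^d)^J}\sum_{j=0}^{J-1}\lambda_j\|x_j-B(x)\|^2\,d\gamma(x),\qquad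 (\ast)$$ where the infimum is over all $\gamma\in GMM((\mathbb R^d)^J)$ with marginals $\mu_0,\dots,\mu_{J-1}$. Then: 1. the infimum in $(\ast)$ is finite and is attained, i.e. an optimal plan $\gamma^*$ exists; 2. for every optimal plan $\gamma^*$ of $(\ast)$, the push-forward $\nu^*=B\#\gamma^*$ belongs to $GMM(\mathbb R^d)$ and solves the $MW_2$-barycenter problem $$\inf_{\nu\in GMM(\mathbb R^d)}\ \sum_{j=0}^{J-1}\lambda_j\,MW_2^2(\mu_j,\nu);$$ 3. the optimal values coincide: $\displaystyle\inf_{\nu\in GMM(\mathbb R^d)}\sum_{j=0}^{J-1}\lambda_j MW_2^2(\mu_j,\nu)=MMW_2^2(\mu_0,\dots,\mu_{J-1})$. -/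

import Mathlib

open MeasureTheory ProbabilityTheory
open scoped ENNReal NNReal

noncomputable section

namespace GMMOT

/-- The Euclidean space `ℝ^d`. -/
abbrev Eucl (d : ℕ) : Type := EuclideanSpace ℝ (Fin d)

/-- Gaussian mixtures of size `K` on a real topological vector space `E` (used for `ℝ^d`,
`ℝ^d × ℝ^d` and `(ℝ^d)^J`): convex combinations of `K` possibly degenerate Gaussian measures.
Weights may vanish, so a mixture of size `K ≥ 1` is also a mixture of every larger size. -/
def gmmOfSize (E : Type*) [TopologicalSpace E] [AddCommMonoid E] [Module ℝ E]
    [MeasurableSpace E] (K : ℕ) : Set (Measure E) :=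
  {μ | ∃ (p : Fin K → ℝ≥0) (g : Fin K → Measure E),
    ∑ k, p k = 1 ∧ (∀ k, IsGaussian (g k)) ∧ μ = ∑ k, p k • g k}

/-- All finite Gaussian mixtures on `E`. -/
def gmm (E : Type*) [TopologicalSpace E] [AddCommMonoid E] [Module ℝ E]
    [MeasurableSpace E] : Set (Measure E) :=
  ⋃ K : ℕ, gmmOfSize E K

/-- Transport plans between `μ` and `ν`: probability measures on `ℝ^d × ℝ^d` with
marginals `μ` and `ν`. -/
def plans {d : ℕ} (μ ν : Measure (Eucl d)) : Set (Measure (Eucl d × Eucl d)) :=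
  {γ | IsProbabilityMeasure γ ∧ γ.map Prod.fst = μ ∧ γ.map Prod.snd = ν}

/-- The squared mixture Wasserstein distance `MW₂²(μ, ν)`: the infimum of the quadratic cost
over the transport plans that are finite Gaussian mixtures. -/
def MW2sq {d : ℕ} (μ ν : Measure (Eucl d)) : ℝ≥0∞ :=
  ⨅ γ ∈ plans μ ν ∩ gmm (Eucl d × Eucl d), ∫⁻ y, ENNReal.ofReal (‖y.1 - y.2‖ ^ 2) ∂γ

/-- Multi-marginal plans: probability measures on `(ℝ^d)^J` with marginals `μ_0, …, μ_{J-1}`. -/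
def multiPlans {d J : ℕ} (μ : Fin J → Measure (Eucl d)) : Set (Measure (Fin J → Eucl d)) :=
  {γ | IsProbabilityMeasure γ ∧ ∀ j, γ.map (fun x => x j) = μ j}

/-- The barycenter map `B(x) = ∑ j, w j • x j`. -/
def baryMap {d J : ℕ} (w : Fin J → ℝ≥0) (x : Fin J → Eucl d) : Eucl d :=
  ∑ j, (w j : ℝ) • x j

/-- The pointwise multi-marginal cost `c(x) = ∑ j, w j * ‖x j - B(x)‖ ^ 2`. -/
def multiCost {d J : ℕ} (w : Fin J → ℝ≥0) (x : Fin J → Eucl d) : ℝ :=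
  ∑ j, (w j : ℝ) * ‖x j - baryMap w x‖ ^ 2

/-- The total cost `∫ c dγ` of a multi-marginal plan. -/
def planCost {d J : ℕ} (w : Fin J → ℝ≥0) (γ : Measure (Fin J → Eucl d)) : ℝ≥0∞ :=
  ∫⁻ x, ENNReal.ofReal (multiCost w x) ∂γ

/-- Admissible plans of the multi-marginal problem restricted to Gaussian mixtures. -/
def gmmMultiPlans {d J : ℕ} (μ : Fin J → Measure (Eucl d)) : Set (Measure (Fin J → Eucl d)) :=
  multiPlans μ ∩ gmm (Fin J → Eucl d)

/-- The optimal value `MMW₂²(μ_0, …, μ_{J-1})` of the restricted multi-marginal problem. -/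
def MMW2sq {d J : ℕ} (w : Fin J → ℝ≥0) (μ : Fin J → Measure (Eucl d)) : ℝ≥0∞ :=
  ⨅ γ ∈ gmmMultiPlans μ, planCost w γ

/-- `γ` is an optimal plan of the restricted multi-marginal problem. -/
def IsOptimalMultiPlan {d J : ℕ} (w : Fin J → ℝ≥0) (μ : Fin J → Measure (Eucl d))
    (γ : Measure (Fin J → Eucl d)) : Prop :=
  γ ∈ gmmMultiPlans μ ∧ IsMinOn (planCost w) (gmmMultiPlans μ) γ

/-- The barycenter functional `ν ↦ ∑ j, w j * MW₂²(μ_j, ν)`. -/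
def baryObjective {d J : ℕ} (w : Fin J → ℝ≥0) (μ : Fin J → Measure (Eucl d))
    (ν : Measure (Eucl d)) : ℝ≥0∞ :=
  ∑ j, (w j : ℝ≥0∞) * MW2sq (μ j) ν

/-- `ν` solves the `MW₂`-barycenter problem. -/
def IsMW2Barycenter {d J : ℕ} (w : Fin J → ℝ≥0) (μ : Fin J → Measure (Eucl d))
    (ν : Measure (Eucl d)) : Prop :=
  ν ∈ gmm (Eucl d) ∧ IsMinOn (baryObjective w μ) (gmm (Eucl d)) ν

end GMMOT

end

noncomputable section

namespace GMMOT

/-! ### Identifiability of finite Gaussian mixtures -/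

/-! Both inequalities between the two problems come from moving plans around inside the class of
mixtures. From a multi-marginal plan, the linear maps `x ↦ (x j, B x)` give mixture plans from each
`μ j` to the image under `B`, with weighted total cost equal to that of the plan
(`baryObjective_map_baryMap_le`). Conversely, plans from the `μ j` to a common `ν` are glued along
`ν`, and the target is then forgotten; this does not raise the cost, because `B x` minimizes `∑ w j
‖x j - y‖²` over `y` (`multiCost_le`, `MMW2sq_le_sum_plans`).

The difficulty is to glue without leaving the class of mixtures. For Gaussian plans with the same
second marginal, regression writes each one as the law of `(noise + R Y, Y)` with noise independent
of `Y`, so that independent noises and a shared `Y` give a Gaussian gluing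
(`exists_isGaussian_gluing`). Mixtures are reduced to this case by identifiability: distinct
Gaussian measures are linearly independent, so a mixture determines the total weight of each
component (`sum_weights_eq_of_mixture_eq`). Hence all plans split compatibly over the components of
`ν` (`exists_gmm_gluing`).

Identifiability also yields existence. Each component of positive weight in an admissible plan
couples one component of each `μ j`. It may be replaced by a cheapest Gaussian coupling of that
tuple, which exists because the cost is continuous on a compact set of covariance matrices. What
remains is a finite linear programme in the weights (`exists_optimal_multiPlan`). -/

open Filter Topology in
/-- The functions `x ↦ exp (a x + b x² / 2)` for distinct pairs `(a, b)` are linearly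
independent. -/
lemma eq_zero_of_sum_mul_exp_quadratic_eq_zero {ι : Type*} (s : Finset ι) (a b c : ι → ℝ)
    (hinj : Set.InjOn (fun i => (a i, b i)) s)
    (h : ∀ x : ℝ, ∑ i ∈ s, c i * Real.exp (a i * x + b i * x ^ 2 / 2) = 0) :
    ∀ i ∈ s, c i = 0 := by
  classical
  by_contra! hne
  obtain ⟨i₀, hi₀, hc₀⟩ := hne
  -- The exponential dominating at `+∞` has the largest `b`, ties being broken by the largest `a`.
  -- After division by it the other terms tend to `0`, so its coefficient must vanish.
  obtain ⟨m, hm, hmax⟩ := (s.filter fun i => c i ≠ 0).exists_max_image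
    (fun i => toLex (b i, a i)) ⟨i₀, by simp [hi₀, hc₀]⟩
  rw [Finset.mem_filter] at hm
  have key : Tendsto (fun x : ℝ => ∑ i ∈ s,
      c i * Real.exp ((a i - a m) * x + (b i - b m) * x ^ 2 / 2)) atTop
      (𝓝 (∑ i ∈ s, if i = m then c m else 0)) := by
    refine tendsto_finsetSum _ fun i hi => ?_
    by_cases him : i = m
    · subst him
      simp
    by_cases hci : c i = 0
    · simp [hci, him]
    rw [if_neg him, ← mul_zero (c i)]
    refine Tendsto.const_mul _ (Real.tendsto_exp_atBot.comp ?_)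
    have hle := hmax i (by simp [hi, hci])
    rw [Prod.Lex.toLex_le_toLex] at hle
    have hrew : (fun x : ℝ => (a i - a m) * x + (b i - b m) * x ^ 2 / 2) =
        fun x : ℝ => x * ((a i - a m) + (b i - b m) / 2 * x) := by
      ext x; ring
    rw [hrew]
    rcases hle with hlt | ⟨heq, hle⟩
    · refine tendsto_id.atTop_mul_atBot₀ ?_
      refine tendsto_atBot_add_const_left _ _ ?_
      exact tendsto_id.const_mul_atTop_of_neg (by simp at hlt; linarith)
    · have hab : a i ≠ a m := fun hab => him (hinj hi hm.1 (by simpa [hab] using heq))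
      have hlt : a i < a m := lt_of_le_of_ne hle hab
      simp only at heq
      simp only [heq, sub_self, zero_div, zero_mul, add_zero]
      exact tendsto_id.atTop_mul_const_of_neg (by linarith)
  have hzero : (fun x : ℝ => ∑ i ∈ s,
      c i * Real.exp ((a i - a m) * x + (b i - b m) * x ^ 2 / 2)) = fun _ => 0 := by
    ext x
    have : ∀ i, c i * Real.exp ((a i - a m) * x + (b i - b m) * x ^ 2 / 2) =
        c i * Real.exp (a i * x + b i * x ^ 2 / 2) *
          Real.exp (-(a m * x + b m * x ^ 2 / 2)) := by
      intro i
      rw [mul_assoc, ← Real.exp_add]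
      ring_nf
    simp_rw [this, ← Finset.sum_mul, h x, zero_mul]
  rw [hzero] at key
  have := tendsto_nhds_unique key tendsto_const_nhds
  simp [hm.1] at this
  exact hm.2 this

/-- Finitely many functions that are polynomial along every line, none of them identically zero,
have a common point where none of them vanishes. -/
lemma exists_forall_ne_zero_of_polynomial_on_lines {V ι : Type*} [AddCommGroup V] [Module ℝ V]
    (s : Finset ι) (f : ι → V → ℝ)
    (hpoly : ∀ i u v, ∃ P : Polynomial ℝ, ∀ x : ℝ, f i (u + x • v) = P.eval x)
    (hne : ∀ i ∈ s, ∃ v, f i v ≠ 0) : ∃ v, ∀ i ∈ s, f i v ≠ 0 := by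
  classical
  induction s using Finset.induction_on with
  | empty => exact ⟨0, by simp⟩
  | insert j s hj ih =>
    obtain ⟨u, hu⟩ := ih fun i hi => hne i (Finset.mem_insert_of_mem hi)
    obtain ⟨v, hv⟩ := hne j (Finset.mem_insert_self _ _)
    -- Restrict to the line through `u` and `v`: the old functions are nonzero at parameter `0`, the
    -- new one at parameter `1`. The product of these nonzero polynomials has a non-root because `ℝ`
    -- is infinite.
    choose P hP using fun i => hpoly i u (v - u)
    have hP0 : ∀ i ∈ insert j s, P i ≠ 0 := by
      intro i hi h0
      rcases Finset.mem_insert.1 hi with rfl | hi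
      · exact hv (by simpa [h0] using hP i 1)
      · exact hu i hi (by simpa [h0] using hP i 0)
    have hprod : ∏ i ∈ insert j s, P i ≠ 0 := Finset.prod_ne_zero_iff.2 hP0
    obtain ⟨x, hx⟩ := Polynomial.exists_eval_ne_zero_of_natDegree_lt_card _ hprod
      (by simpa using Cardinal.natCast_lt_aleph0.trans_le (Cardinal.aleph0_le_mk ℝ))
    rw [Polynomial.eval_prod, Finset.prod_ne_zero_iff] at hx
    exact ⟨u + x • (v - u), fun i hi => by rw [hP]; exact hx i hi⟩

section Identifiability

variable {E : Type*} [NormedAddCommGroup E] [NormedSpace ℝ E] [MeasurableSpace E] [BorelSpace E]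
  [CompleteSpace E] [SecondCountableTopology E]

/-- Under `L` the measure becomes a real Gaussian, whose moment generating function has exactly the
form handled by `eq_zero_of_sum_mul_exp_quadratic_eq_zero`. -/
lemma integral_exp_mul_dual_of_isGaussian (μ : Measure E) [IsGaussian μ] (L : StrongDual ℝ E)
    (x : ℝ) : ∫ y, Real.exp (x * L y) ∂μ =
      Real.exp (L (∫ y, y ∂μ) * x + covarianceBilinDual μ L L * x ^ 2 / 2) := by
  have h := mgf_gaussianReal (IsGaussian.map_eq_gaussianReal (μ := μ) L) x
  rw [mgf, Real.coe_toNNReal _ (variance_nonneg _ _), IsGaussian.integral_dual,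
    ← covarianceBilinDual_self_eq_variance IsGaussian.memLp_two_id] at h
  exact h

lemma integrable_exp_mul_dual_of_isGaussian (μ : Measure E) [IsGaussian μ] (L : StrongDual ℝ E)
    (x : ℝ) : Integrable (fun y => Real.exp (x * L y)) μ :=
  Integrable.of_integral_ne_zero <| by
    rw [integral_exp_mul_dual_of_isGaussian]; exact (Real.exp_pos _).ne'

/-- For finitely many distinct Gaussian measures there is a linear form along which all of them
have distinct one-dimensional parameters. -/
lemma exists_dual_injOn_gaussian_params (s : Finset (Measure E)) (hs : ∀ μ ∈ s, IsGaussian μ) :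
    ∃ L : StrongDual ℝ E,
      Set.InjOn (fun μ : Measure E => (L (∫ y, y ∂μ), covarianceBilinDual μ L L)) s := by
  classical
  -- This vanishes exactly when `L` fails to separate the pair by mean or variance. As a sum of
  -- squares it is a single polynomial condition on `L`.
  let f : Measure E × Measure E → StrongDual ℝ E → ℝ := fun p L =>
    (L (∫ y, y ∂p.1) - L (∫ y, y ∂p.2)) ^ 2 +
      (covarianceBilinDual p.1 L L - covarianceBilinDual p.2 L L) ^ 2
  have hpoly : ∀ p u v, ∃ P : Polynomial ℝ, ∀ x : ℝ, f p (u + x • v) = P.eval x := by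
    intro p u v
    let Q : Measure E → Polynomial ℝ := fun μ =>
      .C (covarianceBilinDual μ u u) +
        .C (covarianceBilinDual μ u v + covarianceBilinDual μ v u) * .X +
        .C (covarianceBilinDual μ v v) * .X ^ 2
    let R : Measure E → Polynomial ℝ := fun μ => .C (u (∫ y, y ∂μ)) + .C (v (∫ y, y ∂μ)) * .X
    refine ⟨(R p.1 - R p.2) ^ 2 + (Q p.1 - Q p.2) ^ 2, fun x => ?_⟩
    simp [f, Q, R]
    ring
  have hne : ∀ p ∈ (s ×ˢ s).filter fun p => p.1 ≠ p.2, ∃ L, f p L ≠ 0 := by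
    intro p hp
    simp only [Finset.mem_filter, Finset.mem_product] at hp
    obtain ⟨⟨h1, h2⟩, hne⟩ := hp
    have := hs _ h1
    have := hs _ h2
    by_contra! h0
    have h0' : ∀ L : StrongDual ℝ E, L (∫ y, y ∂p.1) = L (∫ y, y ∂p.2) ∧
        covarianceBilinDual p.1 L L = covarianceBilinDual p.2 L L := by
      intro L
      have := h0 L
      simp only [f] at this
      constructor <;> nlinarith [sq_nonneg (L (∫ y, y ∂p.1) - L (∫ y, y ∂p.2)),
        sq_nonneg (covarianceBilinDual p.1 L L - covarianceBilinDual p.2 L L)]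
    -- Equal means and variances along every `L` give equal characteristic functions, hence equal
    -- measures.
    refine hne (Measure.ext_of_charFunDual ?_)
    ext L
    rw [IsGaussian.charFunDual_eq', IsGaussian.charFunDual_eq']
    simp only [id_eq]
    rw [(h0' L).1, (h0' L).2]
  obtain ⟨L, hL⟩ := exists_forall_ne_zero_of_polynomial_on_lines _ f hpoly hne
  refine ⟨L, fun μ hμ ν hν h => ?_⟩
  by_contra hne
  refine hL (μ, ν) (by simpa [hne] using ⟨hμ, hν⟩) ?_
  simp only [Prod.mk.injEq] at h
  simp [f, h.1, h.2]

/-- Distinct Gaussian measures are linearly independent. -/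
lemma eq_zero_of_sum_mul_gaussian_eq_zero (s : Finset (Measure E)) (hs : ∀ μ ∈ s, IsGaussian μ)
    (c : Measure E → ℝ)
    (h : ∀ (L : StrongDual ℝ E) (x : ℝ), ∑ μ ∈ s, c μ * ∫ y, Real.exp (x * L y) ∂μ = 0) :
    ∀ μ ∈ s, c μ = 0 := by
  obtain ⟨L, hL⟩ := exists_dual_injOn_gaussian_params s hs
  refine eq_zero_of_sum_mul_exp_quadratic_eq_zero s _ _ c hL fun x => ?_
  rw [← h L x]
  refine Finset.sum_congr rfl fun μ hμ => ?_
  have := hs μ hμ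
  rw [integral_exp_mul_dual_of_isGaussian]

lemma integral_exp_mul_dual_mixture [DecidableEq (Measure E)] (s : Finset (Measure E))
    {ι : Type*} [Fintype ι] (r : ι → ℝ≥0) (m : ι → Measure E) (hm : ∀ i, IsGaussian (m i))
    (hms : ∀ i, m i ∈ s) (L : StrongDual ℝ E) (x : ℝ) :
    ∫ y, Real.exp (x * L y) ∂(∑ i, r i • m i) =
      ∑ μ ∈ s, ((∑ i with m i = μ, r i : ℝ≥0) : ℝ) * ∫ y, Real.exp (x * L y) ∂μ := by
  rw [integral_finsetSum_measure fun i _ => by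
    have := hm i
    exact (integrable_exp_mul_dual_of_isGaussian (m i) L x).smul_measure_nnreal]
  rw [← Finset.sum_fiberwise_of_maps_to (s := Finset.univ) (t := s) (g := m)
    fun i _ => hms i]
  refine Finset.sum_congr rfl fun μ _ => ?_
  rw [NNReal.coe_sum, Finset.sum_mul]
  refine Finset.sum_congr rfl fun i hi => ?_
  rw [Finset.mem_filter] at hi
  rw [integral_smul_nnreal_measure, hi.2, NNReal.smul_def, smul_eq_mul]

/-- Two representations of the same finite Gaussian mixture give the same total weight to every
Gaussian component. -/
lemma sum_weights_eq_of_mixture_eq {ι κ : Type*} [Fintype ι] [Fintype κ]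
    (p : ι → ℝ≥0) (q : κ → ℝ≥0) (g : ι → Measure E) (h : κ → Measure E)
    (hg : ∀ i, IsGaussian (g i)) (hh : ∀ k, IsGaussian (h k))
    (heq : ∑ i, p i • g i = ∑ k, q k • h k) (n : Measure E) [DecidableEq (Measure E)] :
    ∑ i with g i = n, p i = ∑ k with h k = n, q k := by
  -- Over the union of both sets of components, the two mixtures become combinations of the same
  -- distinct Gaussians. Linear independence then applies to the differences of grouped weights.
  let s : Finset (Measure E) := Finset.univ.image g ∪ Finset.univ.image h
  have hgs : ∀ i, g i ∈ s := fun i => by simp [s]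
  have hhs : ∀ k, h k ∈ s := fun k => by simp [s]
  have hs : ∀ μ ∈ s, IsGaussian μ := by
    intro μ hμ
    simp only [s, Finset.mem_union, Finset.mem_image, Finset.mem_univ, true_and] at hμ
    rcases hμ with ⟨i, rfl⟩ | ⟨k, rfl⟩
    exacts [hg i, hh k]
  by_cases hn : n ∈ s
  · have := eq_zero_of_sum_mul_gaussian_eq_zero s hs
      (fun μ => ((∑ i with g i = μ, p i : ℝ≥0) : ℝ) - ((∑ k with h k = μ, q k : ℝ≥0) : ℝ))
      (fun L x => by
        simp_rw [sub_mul, Finset.sum_sub_distrib]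
        rw [← integral_exp_mul_dual_mixture s p g hg hgs, ← integral_exp_mul_dual_mixture s q h hh hhs,
          heq, sub_self]) n hn
    exact NNReal.coe_injective (sub_eq_zero.1 this)
  · rw [Finset.sum_eq_zero, Finset.sum_eq_zero]
    · intro k hk
      simp only [Finset.mem_filter, Finset.mem_univ, true_and] at hk
      exact absurd (hk ▸ hhs k) hn
    · intro i hi
      simp only [Finset.mem_filter, Finset.mem_univ, true_and] at hi
      exact absurd (hi ▸ hgs i) hn

/-- Every component with positive weight of a Gaussian mixture occurs in every other
representation of that mixture. -/
lemma exists_component_eq_of_mixture_eq {ι κ : Type*} [Fintype ι] [Fintype κ]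
    (p : ι → ℝ≥0) (q : κ → ℝ≥0) (g : ι → Measure E) (h : κ → Measure E)
    (hg : ∀ i, IsGaussian (g i)) (hh : ∀ k, IsGaussian (h k))
    (heq : ∑ i, p i • g i = ∑ k, q k • h k) (i : ι) (hi : 0 < p i) : ∃ k, h k = g i := by
  classical
  have hsum := sum_weights_eq_of_mixture_eq p q g h hg hh heq (g i)
  by_contra! hne
  rw [Finset.sum_eq_zero (s := Finset.univ.filter fun k => h k = g i)
    (fun k hk => absurd (Finset.mem_filter.1 hk).2 (hne k)), Finset.sum_eq_zero_iff] at hsum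
  exact hi.ne' (hsum i (by simp))

end Identifiability

/-! ### Linear regression and gluing for Gaussian measures -/

section Regression

open scoped RealInnerProductSpace

variable {E F : Type*} [NormedAddCommGroup E] [InnerProductSpace ℝ E] [FiniteDimensional ℝ E]
  [NormedAddCommGroup F] [InnerProductSpace ℝ F] [FiniteDimensional ℝ F]

/-- A linear map factors through another one as soon as the ranges are contained in each other. -/
lemma exists_comp_eq_of_range_le {U V W : Type*} [AddCommGroup U] [Module ℝ U] [AddCommGroup V]
    [Module ℝ V] [AddCommGroup W] [Module ℝ W] (S : V →ₗ[ℝ] W) (C : U →ₗ[ℝ] W)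
    (h : LinearMap.range C ≤ LinearMap.range S) : ∃ T : U →ₗ[ℝ] V, S ∘ₗ T = C := by
  obtain ⟨T, hT⟩ := Module.projective_lifting_property S.rangeRestrict
    (C.codRestrict (LinearMap.range S) fun x => h ⟨x, rfl⟩) S.surjective_rangeRestrict
  refine ⟨T, LinearMap.ext fun x => ?_⟩
  simpa using congrArg Subtype.val (LinearMap.congr_fun hT x)

/-- Riesz representation of a bilinear form by a linear map. -/
lemma exists_linearMap_inner_eq {U : Type*} [NormedAddCommGroup U] [NormedSpace ℝ U]
    (b : U →L[ℝ] F →L[ℝ] ℝ) : ∃ S : U →ₗ[ℝ] F, ∀ u v, ⟪S u, v⟫ = b u v :=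
  ⟨{ toFun := fun u => (InnerProductSpace.toDual ℝ F).symm (b u)
     map_add' := fun u v => by simp
     map_smul' := fun c u => by simp },
    fun u v => InnerProductSpace.toDual_symm_apply⟩

variable [MeasurableSpace E] [BorelSpace E] [MeasurableSpace F] [BorelSpace F]

/-- Existence of the regression map: for a measure with second moments on a product space there is
a linear `R` such that `X - R Y` is uncorrelated with `Y`. -/
lemma exists_regression (h : Measure (E × F)) [IsProbabilityMeasure h] (hmem : MemLp id 2 h) :
    ∃ R : F →L[ℝ] E, ∀ (x : E) (y : F),
      cov[fun z : E × F => ⟪x, z.1 - R z.2⟫, fun z => ⟪y, z.2⟫; h] = 0 := by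
  let f₁ : E →L[ℝ] StrongDual ℝ (E × F) :=
    (ContinuousLinearMap.compL ℝ (E × F) E ℝ).flip (ContinuousLinearMap.fst ℝ E F) ∘L innerSL ℝ
  let f₂ : F →L[ℝ] StrongDual ℝ (E × F) :=
    (ContinuousLinearMap.compL ℝ (E × F) F ℝ).flip (ContinuousLinearMap.snd ℝ E F) ∘L innerSL ℝ
  have hf₁ : ∀ x z, f₁ x z = ⟪x, z.1⟫ := fun x z => rfl
  have hf₂ : ∀ y z, f₂ y z = ⟪y, z.2⟫ := fun y z => rfl
  let B := covarianceBilinDual h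
  -- Writing `h` as the law of `(X, Y)`, `S` is the covariance operator of `Y` and `C` the
  -- cross-covariance. A solution `T` of the normal equation `S ∘ T = C` gives `R` as its adjoint.
  obtain ⟨S, hS⟩ := exists_linearMap_inner_eq (B.bilinearComp f₂ f₂)
  obtain ⟨C, hC⟩ := exists_linearMap_inner_eq (B.bilinearComp f₁ f₂)
  simp only [ContinuousLinearMap.bilinearComp_apply] at hS hC
  have hsymm : S.adjoint = S := by
    refine ((LinearMap.eq_adjoint_iff S S).2 fun a b => ?_).symm
    rw [hS, real_inner_comm, hS]
    exact covarianceBilinDual_comm _ _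
  -- `S` may be singular. If `v` is in its kernel, `⟪v, Y⟫` has variance zero, so by Cauchy–Schwarz
  -- it is uncorrelated with `X`. Thus the range of `C` is orthogonal to `ker S`, that is, contained
  -- in the range of `S`.
  have hrange : LinearMap.range C ≤ LinearMap.range S := by
    rw [← hsymm, ← LinearMap.orthogonal_ker]
    rintro _ ⟨x, rfl⟩
    rw [Submodule.mem_orthogonal']
    intro v hv
    have hv0 : B (f₂ v) (f₂ v) = 0 := by
      rw [← hS, LinearMap.mem_ker.1 hv, inner_zero_left]
    rw [hC]
    have hCS := B.toBilinForm.apply_mul_apply_le_of_forall_zero_le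
      isPosSemidef_covarianceBilinDual.nonneg (f₁ x) (f₂ v)
    simp only [ContinuousLinearMap.toBilinForm_apply, hv0, mul_zero] at hCS
    rw [show B (f₂ v) (f₁ x) = B (f₁ x) (f₂ v) from covarianceBilinDual_comm _ _] at hCS
    exact mul_self_eq_zero.1 (le_antisymm hCS (mul_self_nonneg _))
  obtain ⟨T, hT⟩ := exists_comp_eq_of_range_le S C hrange
  refine ⟨(LinearMap.adjoint T).toContinuousLinearMap, fun x y => ?_⟩
  have h1 : (fun z : E × F => ⟪x, z.1 - (LinearMap.adjoint T).toContinuousLinearMap z.2⟫) =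
      (f₁ x - f₂ (T x) : StrongDual ℝ (E × F)) := by
    ext z
    simp [hf₁, hf₂, inner_sub_right, LinearMap.adjoint_inner_right]
  have h2 : (fun z : E × F => ⟪y, z.2⟫) = f₂ y := by
    ext z; rw [hf₂]
  rw [h1, h2, ← covarianceBilinDual_eq_covariance hmem]
  have := LinearMap.congr_fun hT x
  simp only [LinearMap.comp_apply] at this
  rw [map_sub, sub_apply]
  change B (f₁ x) (f₂ y) - B (f₂ (T x)) (f₂ y) = 0
  rw [← hC, ← hS, this, sub_self]

/-- A Gaussian measure on a product is obtained from its second marginal by adding an independent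
Gaussian noise to a linear function. -/
lemma exists_eq_map_prod_of_isGaussian (h : Measure (E × F)) [IsGaussian h] :
    ∃ (R : F →L[ℝ] E) (ρ : Measure E), IsGaussian ρ ∧
      h = (ρ.prod (h.map Prod.snd)).map fun z => (z.1 + R z.2, z.2) := by
  obtain ⟨R, hR⟩ := exists_regression h IsGaussian.memLp_two_id
  let A : E × F →L[ℝ] E × F := (ContinuousLinearMap.fst ℝ E F -
    R ∘L ContinuousLinearMap.snd ℝ E F).prod (ContinuousLinearMap.snd ℝ E F)
  have hlaw : HasGaussianLaw (fun z : E × F => (z.1 - R z.2, z.2)) h :=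
    ⟨(inferInstance : IsGaussian (h.map A))⟩
  -- Jointly Gaussian and uncorrelated, the residual and `Y` are independent.
  have hind := hlaw.indepFun_of_covariance_inner hR
  rw [indepFun_iff_map_prod_eq_prod_map_map (by fun_prop) (by fun_prop)] at hind
  refine ⟨R, h.map fun z => z.1 - R z.2, hlaw.fst.isGaussian_map, ?_⟩
  change h = ((h.map fun z => z.1 - R z.2).prod (h.map fun z => z.2)).map _
  rw [← hind, Measure.map_map (by fun_prop) (by fun_prop)]
  simp [Function.comp_def]

end Regression

lemma isGaussian_pi {ι : Type*} [Fintype ι] {E : ι → Type*} [∀ i, NormedAddCommGroup (E i)]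
    [∀ i, NormedSpace ℝ (E i)] [∀ i, MeasurableSpace (E i)] [∀ i, BorelSpace (E i)]
    [∀ i, SecondCountableTopology (E i)] [∀ i, CompleteSpace (E i)]
    (ρ : ∀ i, Measure (E i)) (hρ : ∀ i, IsGaussian (ρ i)) : IsGaussian (Measure.pi ρ) := by
  have h := (iIndepFun_pi (μ := ρ) (X := fun i => (id : E i → E i))
    fun i => aemeasurable_id).hasGaussianLaw fun i =>
      ⟨by
        have := (measurePreserving_eval ρ i).map_eq
        simp only [id_eq]
        change IsGaussian ((Measure.pi ρ).map (Function.eval i))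
        rw [this]
        exact hρ i⟩
  have := h.isGaussian_map
  simpa using this

/-- Gluing of Gaussian plans along a common second marginal. -/
lemma exists_isGaussian_gluing {d J : ℕ} (h : Fin J → Measure (Eucl d × Eucl d))
    (hh : ∀ j, IsGaussian (h j)) (n : Measure (Eucl d)) (hn : IsGaussian n)
    (hsnd : ∀ j, (h j).map Prod.snd = n) :
    ∃ γ : Measure ((Fin J → Eucl d) × Eucl d), IsGaussian γ ∧
      ∀ j, γ.map (fun z => (z.1 j, z.2)) = h j := by
  choose R ρ hρ heq using fun j => exists_eq_map_prod_of_isGaussian (h j)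
  have := isGaussian_pi ρ hρ
  -- One shared `y` and independent residuals are sent to `x j = residual j + R j y`.
  let A : (Fin J → Eucl d) × Eucl d →L[ℝ] (Fin J → Eucl d) × Eucl d :=
    (ContinuousLinearMap.pi fun j =>
      (ContinuousLinearMap.proj j : (Fin J → Eucl d) →L[ℝ] Eucl d) ∘L ContinuousLinearMap.fst ℝ _ _ +
      R j ∘L ContinuousLinearMap.snd ℝ _ _).prod (ContinuousLinearMap.snd ℝ _ _)
  refine ⟨((Measure.pi ρ).prod n).map A, inferInstance, fun j => ?_⟩
  rw [Measure.map_map (by fun_prop) (by fun_prop), heq j, hsnd j,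
    ← (measurePreserving_eval ρ j).map_eq, ← Measure.map_id (μ := n),
    Measure.map_prod_map _ _ (by fun_prop) (by fun_prop),
    Measure.map_map (by fun_prop) (by fun_prop)]
  simp only [Measure.map_id]
  rfl

/-! ### Optimal Gaussian couplings of Gaussian measures -/

section Multivariate

open scoped RealInnerProductSpace Matrix

variable {ι : Type*} [Fintype ι]

/-- The covariance matrix of a measure on a Euclidean space. -/
def covMatrix (θ : Measure (EuclideanSpace ℝ ι)) : Matrix ι ι ℝ :=
  Matrix.of fun a b =>
    covarianceBilin θ (EuclideanSpace.basisFun ι ℝ a) (EuclideanSpace.basisFun ι ℝ b)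

lemma dotProduct_mulVec_of_bilin (B : EuclideanSpace ℝ ι →L[ℝ] EuclideanSpace ℝ ι →L[ℝ] ℝ)
    (x y : EuclideanSpace ℝ ι) :
    x ⬝ᵥ (Matrix.of fun a b => B (EuclideanSpace.basisFun ι ℝ a)
      (EuclideanSpace.basisFun ι ℝ b)) *ᵥ y = B x y := by
  conv_rhs => rw [← (EuclideanSpace.basisFun ι ℝ).sum_repr x,
    ← (EuclideanSpace.basisFun ι ℝ).sum_repr y]
  simp only [map_sum, map_smul, sum_apply, smul_apply,
    dotProduct, Matrix.mulVec, Matrix.of_apply, EuclideanSpace.basisFun_repr, smul_eq_mul,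
    Finset.mul_sum]
  rw [Finset.sum_comm]
  refine Finset.sum_congr rfl fun b _ => Finset.sum_congr rfl fun a _ => by ring

lemma posSemidef_covMatrix (θ : Measure (EuclideanSpace ℝ ι)) : (covMatrix θ).PosSemidef := by
  refine Matrix.PosSemidef.of_dotProduct_mulVec_nonneg ?_ fun x => ?_
  · ext a b
    simpa [covMatrix] using covarianceBilin_comm _ _
  · have := dotProduct_mulVec_of_bilin (covarianceBilin θ) (WithLp.toLp 2 x) (WithLp.toLp 2 x)
    simp only [star_trivial]
    exact this.symm ▸ covarianceBilin_self_nonneg _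

lemma integrable_inner_sq_of_isGaussian (θ : Measure (EuclideanSpace ℝ ι)) [IsGaussian θ]
    (c : EuclideanSpace ℝ ι) : Integrable (fun z => ⟪c, z⟫ ^ 2) θ :=
  (IsGaussian.memLp_dual θ (innerSL ℝ c) 2 (by simp)).integrable_sq

variable [DecidableEq ι]

/-- A Gaussian measure on a Euclidean space is determined by its mean and covariance matrix. -/
lemma eq_multivariateGaussian_of_isGaussian (θ : Measure (EuclideanSpace ℝ ι)) [IsGaussian θ] :
    θ = multivariateGaussian (∫ x, x ∂θ) (covMatrix θ) := by
  refine IsGaussian.ext ?_ ?_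
  · simp
  · ext x y
    rw [covarianceBilin_multivariateGaussian (posSemidef_covMatrix θ)]
    exact (dotProduct_mulVec_of_bilin _ x y).symm

lemma covMatrix_multivariateGaussian (m : EuclideanSpace ℝ ι) {S : Matrix ι ι ℝ}
    (hS : S.PosSemidef) : covMatrix (multivariateGaussian m S) = S := by
  ext a b
  simp [covMatrix, covarianceBilin_multivariateGaussian hS]

lemma integral_inner_sq_multivariateGaussian (m c : EuclideanSpace ℝ ι) {S : Matrix ι ι ℝ}
    (hS : S.PosSemidef) :
    ∫ z, ⟪c, z⟫ ^ 2 ∂(multivariateGaussian m S) = ⟪c, m⟫ ^ 2 + c ⬝ᵥ S *ᵥ c := by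
  have hmem := IsGaussian.memLp_dual (multivariateGaussian m S) (innerSL ℝ c) 2 (by simp)
  have hvar := variance_eq_sub hmem
  have hcov := covarianceBilin_self (μ := multivariateGaussian m S) IsGaussian.memLp_two_id c
  rw [covarianceBilin_multivariateGaussian hS] at hcov
  have hmean := IsGaussian.integral_dual (μ := multivariateGaussian m S) (innerSL ℝ c)
  rw [integral_id_multivariateGaussian] at hmean
  rw [hmean] at hvar
  simp only [innerSL_apply_apply, Pi.pow_apply] at hvar
  rw [hcov]
  change Var[fun u => ⟪c, u⟫; _] = _ at hvar
  rw [hvar]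
  ring

/-- Positive semidefinite matrices whose diagonal and possibly further entries are prescribed form
a compact set. -/
lemma isCompact_posSemidef_prescribed (r : ι → ι → Prop) (hr : ∀ a, r a a) (C : Matrix ι ι ℝ) :
    IsCompact {S : Matrix ι ι ℝ | S.PosSemidef ∧ ∀ a b, r a b → S a b = C a b} := by
  have hclosed : IsClosed {S : Matrix ι ι ℝ | S.PosSemidef ∧ ∀ a b, r a b → S a b = C a b} := by
    simp only [Matrix.posSemidef_iff_dotProduct_mulVec, Matrix.IsHermitian, Set.ofPred_and,
      Set.ofPred_forall]
    refine ((isClosed_eq (by fun_prop) (by fun_prop)).inter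
      (isClosed_iInter fun x => isClosed_le (by fun_prop) (by fun_prop))).inter
      (isClosed_iInter fun a => isClosed_iInter fun b => isClosed_iInter fun _ =>
        isClosed_eq (by fun_prop) (by fun_prop))
  let M : ℝ := ∑ a, |C a a|
  have hsub : {S : Matrix ι ι ℝ | S.PosSemidef ∧ ∀ a b, r a b → S a b = C a b} ⊆
      Set.pi Set.univ fun _ => Set.pi Set.univ fun _ => Set.Icc (-M) M := by
    rintro S ⟨hS, hSC⟩ a - b -
    have hM : ∀ a, S a a ≤ M := fun a => by
      rw [hSC a a (hr a)]
      exact (le_abs_self _).trans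
        (Finset.single_le_sum (f := fun a => |C a a|) (fun _ _ => abs_nonneg _)
          (Finset.mem_univ a))
    have hsymm : S b a = S a b := by simpa using hS.isHermitian.apply a b
    -- Testing with `e_a ± e_b` gives `2 |S a b| ≤ S a a + S b b ≤ 2 M`, so the prescribed diagonal
    -- bounds every entry.
    have h1 := hS.dotProduct_mulVec_nonneg (Pi.single a 1 + Pi.single b 1)
    have h2 := hS.dotProduct_mulVec_nonneg (Pi.single a 1 - Pi.single b 1)
    simp [Matrix.mulVec_add, Matrix.mulVec_sub, add_dotProduct, sub_dotProduct,
      hsymm] at h1 h2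
    have := hM a
    have := hM b
    constructor <;> linarith
  exact IsCompact.of_isClosed_subset
    (isCompact_univ_pi fun _ => isCompact_univ_pi fun _ => isCompact_Icc) hclosed hsub

end Multivariate

/-! ### Gaussian couplings parametrized by their covariance matrices -/

section Coupling

open scoped RealInnerProductSpace Matrix

variable {d J : ℕ}

/-- The identification of `(ℝ^d)^J` with the Euclidean space `ℝ^(J × d)`. -/
def flatten (d J : ℕ) : (Fin J → Eucl d) ≃L[ℝ] EuclideanSpace ℝ (Fin J × Fin d) :=
  LinearEquiv.toContinuousLinearEquiv
    { toFun := fun x => WithLp.toLp 2 fun a => x a.1 a.2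
      invFun := fun z j => WithLp.toLp 2 fun i => z (j, i)
      map_add' := fun x y => by ext; simp
      map_smul' := fun c x => by ext; simp
      left_inv := fun x => by ext; simp
      right_inv := fun z => by ext; simp }

lemma flatten_apply (x : Fin J → Eucl d) (a : Fin J × Fin d) : flatten d J x a = x a.1 a.2 := rfl

lemma flatten_symm_apply (z : EuclideanSpace ℝ (Fin J × Fin d)) (j : Fin J) (i : Fin d) :
    (flatten d J).symm z j i = z (j, i) := rfl

/-- The projection of `ℝ^(J × d)` to the `j`-th block. -/
def block (d : ℕ) {J : ℕ} (j : Fin J) : EuclideanSpace ℝ (Fin J × Fin d) →L[ℝ] Eucl d :=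
  (ContinuousLinearMap.proj j : (Fin J → Eucl d) →L[ℝ] Eucl d) ∘L
    ((flatten d J).symm : EuclideanSpace ℝ (Fin J × Fin d) →L[ℝ] (Fin J → Eucl d))

lemma block_apply (j : Fin J) (z : EuclideanSpace ℝ (Fin J × Fin d)) (i : Fin d) :
    block d j z i = z (j, i) := rfl

lemma adjoint_block_basisFun (j : Fin J) (i : Fin d) :
    (block d j).adjoint (EuclideanSpace.basisFun _ ℝ i) = EuclideanSpace.basisFun _ ℝ (j, i) := by
  refine ext_inner_right ℝ fun z => ?_
  rw [ContinuousLinearMap.adjoint_inner_left]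
  simp [block_apply, EuclideanSpace.inner_single_left]

/-- The covariance matrix of a block is the corresponding block of the covariance matrix. -/
lemma covMatrix_map_block (θ : Measure (EuclideanSpace ℝ (Fin J × Fin d))) [IsGaussian θ]
    (j : Fin J) (i i' : Fin d) :
    covMatrix (θ.map (block d j)) i i' = covMatrix θ (j, i) (j, i') := by
  simp only [covMatrix, Matrix.of_apply]
  rw [covarianceBilin_map IsGaussian.memLp_two_id, adjoint_block_basisFun, adjoint_block_basisFun]

lemma map_flatten_map_block (γ : Measure (Fin J → Eucl d)) (j : Fin J) :
    (γ.map (flatten d J)).map (block d j) = γ.map fun x => x j := by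
  rw [Measure.map_map (by fun_prop) (by fun_prop)]
  congr 1

lemma map_flatten_symm_map_eval (θ : Measure (EuclideanSpace ℝ (Fin J × Fin d))) (j : Fin J) :
    (θ.map (flatten d J).symm).map (fun x => x j) = θ.map (block d j) := by
  rw [Measure.map_map (by fun_prop) (by fun_prop)]
  rfl

/-- The mean of a coupling, in terms of the means of the marginals. -/
def couplingMean (g : Fin J → Measure (Eucl d)) : EuclideanSpace ℝ (Fin J × Fin d) :=
  flatten d J fun j => ∫ x, x ∂(g j)

/-- The covariance matrices of the couplings of the Gaussian measures `g j`. -/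
def couplingCov (g : Fin J → Measure (Eucl d)) :
    Set (Matrix (Fin J × Fin d) (Fin J × Fin d) ℝ) :=
  {S | S.PosSemidef ∧ ∀ a b : Fin J × Fin d, a.1 = b.1 → S a b = covMatrix (g a.1) a.2 b.2}

lemma isCompact_couplingCov (g : Fin J → Measure (Eucl d)) : IsCompact (couplingCov g) :=
  isCompact_posSemidef_prescribed (fun a b : Fin J × Fin d => a.1 = b.1) (fun _ => rfl)
    (Matrix.of fun a b => covMatrix (g a.1) a.2 b.2)

/-- Every Gaussian coupling is given by a matrix in `couplingCov`. -/
lemma exists_couplingCov_of_isGaussian (g : Fin J → Measure (Eucl d))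
    (γ : Measure (Fin J → Eucl d)) [IsGaussian γ] (hγ : ∀ j, γ.map (fun x => x j) = g j) :
    ∃ S ∈ couplingCov g,
      γ = (multivariateGaussian (couplingMean g) S).map (flatten d J).symm := by
  obtain ⟨θ, hθdef⟩ : ∃ θ, θ = γ.map (flatten d J) := ⟨_, rfl⟩
  have hθ : IsGaussian θ := hθdef ▸ isGaussian_map_equiv _
  have hblock : ∀ j, θ.map (block d j) = g j := fun j => by
    rw [hθdef, map_flatten_map_block, hγ]
  have hmean : ∫ z, z ∂θ = couplingMean g := by
    ext a
    rw [couplingMean, flatten_apply, ← hblock, integral_map (by fun_prop) (by fun_prop),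
      (block d a.1).integral_comp_id_comm IsGaussian.integrable_id, block_apply]
  refine ⟨covMatrix θ, ⟨posSemidef_covMatrix θ, ?_⟩, ?_⟩
  · rintro ⟨j, i⟩ ⟨j', i'⟩ (rfl : j = j')
    rw [← hblock, covMatrix_map_block]
  · rw [← hmean, ← eq_multivariateGaussian_of_isGaussian, hθdef,
      Measure.map_map (by fun_prop) (by fun_prop)]
    simp

/-- Every matrix in `couplingCov` gives a Gaussian coupling. -/
lemma map_eval_of_mem_couplingCov (g : Fin J → Measure (Eucl d)) (hg : ∀ j, IsGaussian (g j))
    {S : Matrix (Fin J × Fin d) (Fin J × Fin d) ℝ} (hS : S ∈ couplingCov g) (j : Fin J) :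
    ((multivariateGaussian (couplingMean g) S).map (flatten d J).symm).map (fun x => x j) =
      g j := by
  rw [map_flatten_symm_map_eval]
  have := hg j
  rw [eq_multivariateGaussian_of_isGaussian (g j),
    eq_multivariateGaussian_of_isGaussian (Measure.map _ _)]
  congr 1
  · rw [integral_map (by fun_prop) (by fun_prop),
      (block d j).integral_comp_id_comm IsGaussian.integrable_id, integral_id_multivariateGaussian]
    ext i
    rfl
  · ext i i'
    rw [covMatrix_map_block, covMatrix_multivariateGaussian _ hS.1]
    exact hS.2 (j, i) (j, i') rfl

/-- The linear forms whose squares add up to the multi-marginal cost. -/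
def costVector (w : Fin J → ℝ≥0) (a : Fin J × Fin d) : EuclideanSpace ℝ (Fin J × Fin d) :=
  EuclideanSpace.single a 1 - ∑ l, (w l : ℝ) • EuclideanSpace.single (l, a.2) 1

/-- `⟪costVector w (j, i), z⟫` is the `i`-th coordinate of `x j - B x`. The cost is thus a quadratic
form, and its expectation involves only first and second moments. -/
lemma multiCost_flatten_symm (w : Fin J → ℝ≥0) (z : EuclideanSpace ℝ (Fin J × Fin d)) :
    multiCost w ((flatten d J).symm z) =
      ∑ a : Fin J × Fin d, (w a.1 : ℝ) * ⟪costVector w a, z⟫ ^ 2 := by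
  rw [multiCost, Fintype.sum_prod_type]
  refine Finset.sum_congr rfl fun j _ => ?_
  rw [EuclideanSpace.real_norm_sq_eq, Finset.mul_sum]
  refine Finset.sum_congr rfl fun i _ => ?_
  simp [costVector, baryMap, inner_sub_left, sum_inner, inner_smul_left, flatten_symm_apply,
    EuclideanSpace.inner_single_left]

lemma continuous_baryMap (w : Fin J → ℝ≥0) : Continuous (baryMap (d := d) w) := by
  unfold baryMap; fun_prop

lemma continuous_multiCost (w : Fin J → ℝ≥0) : Continuous (multiCost (d := d) w) := by
  have := continuous_baryMap (d := d) w
  unfold multiCost; fun_prop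

/-- The cost of a Gaussian coupling as a function of its covariance matrix. -/
def covCost (w : Fin J → ℝ≥0) (m : EuclideanSpace ℝ (Fin J × Fin d))
    (S : Matrix (Fin J × Fin d) (Fin J × Fin d) ℝ) : ℝ :=
  ∑ a : Fin J × Fin d, (w a.1 : ℝ) *
    (⟪costVector w a, m⟫ ^ 2 + costVector w a ⬝ᵥ S *ᵥ costVector w a)

/-- With the mean fixed by the marginals, this makes the cost an affine function of `S`, so
minimizing over couplings is a continuous problem on a compact set. -/
lemma planCost_map_flatten_symm (w : Fin J → ℝ≥0) (m : EuclideanSpace ℝ (Fin J × Fin d))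
    {S : Matrix (Fin J × Fin d) (Fin J × Fin d) ℝ} (hS : S.PosSemidef) :
    planCost w ((multivariateGaussian m S).map (flatten d J).symm) =
      ENNReal.ofReal (covCost w m S) := by
  rw [planCost, lintegral_map (continuous_multiCost w).measurable.ennreal_ofReal (by fun_prop)]
  simp_rw [multiCost_flatten_symm]
  rw [← ofReal_integral_eq_lintegral_ofReal]
  · congr 1
    rw [integral_finsetSum _ fun a _ => (integrable_inner_sq_of_isGaussian _ _).const_mul _]
    simp_rw [integral_const_mul, integral_inner_sq_multivariateGaussian m _ hS]
    rfl
  · exact integrable_finsetSum _ fun a _ => (integrable_inner_sq_of_isGaussian _ _).const_mul _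
  · exact Filter.Eventually.of_forall fun z => Finset.sum_nonneg fun _ _ => by positivity

/-- Among the Gaussian couplings of given Gaussian measures there is one of least cost, and this
cost is finite. -/
lemma exists_optimal_gaussian_coupling (w : Fin J → ℝ≥0) (g : Fin J → Measure (Eucl d))
    (hg : ∀ j, IsGaussian (g j)) :
    ∃ γ : Measure (Fin J → Eucl d), IsGaussian γ ∧ (∀ j, γ.map (fun x => x j) = g j) ∧
      planCost w γ ≠ ∞ ∧
      ∀ γ', IsGaussian γ' → (∀ j, γ'.map (fun x => x j) = g j) → planCost w γ ≤ planCost w γ' := by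
  have hne : (couplingCov g).Nonempty := by
    have := isGaussian_pi g hg
    obtain ⟨S, hS, -⟩ := exists_couplingCov_of_isGaussian g (Measure.pi g)
      fun j => (measurePreserving_eval g j).map_eq
    exact ⟨S, hS⟩
  have hcont : Continuous (covCost w (couplingMean g)) := by
    unfold covCost; fun_prop
  obtain ⟨S, hS, hmin⟩ := (isCompact_couplingCov g).exists_isMinOn hne hcont.continuousOn
  refine ⟨(multivariateGaussian (couplingMean g) S).map (flatten d J).symm,
    isGaussian_map_equiv _, map_eval_of_mem_couplingCov g hg hS, ?_, fun γ' hγ' hmarg => ?_⟩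
  · rw [planCost_map_flatten_symm _ _ hS.1]
    exact ENNReal.ofReal_ne_top
  · obtain ⟨S', hS', rfl⟩ := exists_couplingCov_of_isGaussian g γ' hmarg
    rw [planCost_map_flatten_symm _ _ hS.1, planCost_map_flatten_symm _ _ hS'.1]
    exact ENNReal.ofReal_le_ofReal (hmin hS')

end Coupling

/-! ### Operations on mixtures -/

section Mixtures

variable {E F : Type*} [NormedAddCommGroup E] [NormedSpace ℝ E] [MeasurableSpace E] [BorelSpace E]
  [NormedAddCommGroup F] [NormedSpace ℝ F] [MeasurableSpace F] [BorelSpace F]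

lemma sum_smul_mem_gmm {ι E : Type*} [TopologicalSpace E] [AddCommMonoid E] [Module ℝ E]
    [MeasurableSpace E] [Fintype ι] (p : ι → ℝ≥0) (g : ι → Measure E)
    (hp : ∑ i, p i = 1) (hg : ∀ i, IsGaussian (g i)) : ∑ i, p i • g i ∈ gmm E := by
  refine Set.mem_iUnion.2 ⟨Fintype.card ι, p ∘ (Fintype.equivFin ι).symm,
    g ∘ (Fintype.equivFin ι).symm, ?_, fun k => hg _, ?_⟩
  · rw [← hp]
    exact (Fintype.equivFin ι).symm.sum_comp p
  · exact ((Fintype.equivFin ι).symm.sum_comp fun i => p i • g i).symm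

/-- A finite Gaussian mixture can be written with positive weights. -/
lemma exists_pos_weights_of_mem_gmm {E : Type*} [TopologicalSpace E] [AddCommMonoid E]
    [Module ℝ E] [MeasurableSpace E] {μ : Measure E} (hμ : μ ∈ gmm E) :
    ∃ (κ : Type) (_ : Fintype κ) (p : κ → ℝ≥0) (g : κ → Measure E),
      ∑ k, p k = 1 ∧ (∀ k, 0 < p k) ∧ (∀ k, IsGaussian (g k)) ∧ μ = ∑ k, p k • g k := by
  classical
  obtain ⟨K, p, g, hp, hg, rfl⟩ := Set.mem_iUnion.1 hμ
  refine ⟨{k // p k ≠ 0}, inferInstance, fun k => p k, fun k => g k, ?_,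
    fun k => pos_iff_ne_zero.2 k.2, fun k => hg k, ?_⟩
  · rw [← hp, ← Finset.sum_filter_of_ne (p := fun k => p k ≠ 0) fun k _ h => h]
    exact (Finset.sum_subtype _ (by simp) _).symm
  · rw [← Finset.sum_filter_of_ne (p := fun k => p k ≠ 0) fun k _ h hk => h (by simp [hk])]
    exact Finset.sum_subtype _ (by simp) _

lemma isProbabilityMeasure_of_mem_gmm {E : Type*} [TopologicalSpace E] [AddCommMonoid E]
    [Module ℝ E] [MeasurableSpace E] {μ : Measure E} (hμ : μ ∈ gmm E) :
    IsProbabilityMeasure μ := by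
  obtain ⟨K, p, g, hp, hg, rfl⟩ := Set.mem_iUnion.1 hμ
  refine ⟨?_⟩
  simp only [Measure.finsetSum_apply, Measure.smul_apply, measure_univ, ENNReal.smul_def,
    smul_eq_mul, mul_one]
  exact_mod_cast hp

/-- Convex combinations of Gaussian mixtures are Gaussian mixtures. -/
lemma sum_smul_mem_gmm_of_mem_gmm {ι E : Type*} [TopologicalSpace E] [AddCommMonoid E]
    [Module ℝ E] [MeasurableSpace E] [Fintype ι] (q : ι → ℝ≥0) (μ : ι → Measure E)
    (hq : ∑ i, q i = 1) (hμ : ∀ i, μ i ∈ gmm E) : ∑ i, q i • μ i ∈ gmm E := by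
  choose κ hκ p g hp _ hg hμ using fun i => exists_pos_weights_of_mem_gmm (hμ i)
  have : ∑ i, q i • μ i = ∑ a : (Σ i, κ i), (q a.1 * p a.1 a.2) • g a.1 a.2 := by
    rw [Fintype.sum_sigma]
    refine Finset.sum_congr rfl fun i _ => ?_
    conv_lhs => rw [hμ i, Finset.smul_sum]
    simp_rw [smul_smul]
  rw [this]
  refine sum_smul_mem_gmm _ _ ?_ fun a => hg _ _
  rw [Fintype.sum_sigma]
  simp_rw [← Finset.mul_sum, hp, mul_one, hq]

lemma map_sum_smul {ι X Y : Type*} [MeasurableSpace X] [MeasurableSpace Y] [Fintype ι]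
    (p : ι → ℝ≥0) (g : ι → Measure X) {f : X → Y} (hf : Measurable f) :
    (∑ i, p i • g i).map f = ∑ i, p i • (g i).map f := by
  rw [Measure.map_finset_sum' hf.aemeasurable]
  simp_rw [Measure.map_smul]

lemma lintegral_sum_smul {ι X : Type*} [MeasurableSpace X] [Fintype ι]
    (p : ι → ℝ≥0) (g : ι → Measure X) (f : X → ℝ≥0∞) :
    ∫⁻ x, f x ∂(∑ i, p i • g i) = ∑ i, (p i : ℝ≥0∞) * ∫⁻ x, f x ∂(g i) := by
  rw [lintegral_finsetSum_measure]
  simp_rw [lintegral_smul_measure, ENNReal.smul_def, smul_eq_mul]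

lemma map_mem_gmm {μ : Measure E} (hμ : μ ∈ gmm E) (L : E →L[ℝ] F) : μ.map L ∈ gmm F := by
  obtain ⟨κ, _, p, g, hp, -, hg, rfl⟩ := exists_pos_weights_of_mem_gmm hμ
  rw [map_sum_smul _ _ (by fun_prop)]
  exact sum_smul_mem_gmm _ _ hp fun k => inferInstance

end Mixtures

/-! ### Finite probability vectors and optimization over mixture weights -/

/-- Marginals of a product of finite probability vectors. -/
lemma sum_prod_smul_apply {ι M : Type*} {κ : ι → Type*} [Fintype ι] [DecidableEq ι]
    [∀ i, Fintype (κ i)] [AddCommMonoid M] [Module ℝ≥0 M] (p : ∀ i, κ i → ℝ≥0)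
    (hp : ∀ i, ∑ k, p i k = 1) (j : ι) (f : κ j → M) :
    ∑ α : ∀ i, κ i, (∏ i, p i (α i)) • f (α j) = ∑ k, p j k • f k := by
  classical
  rw [← Finset.sum_fiberwise_of_maps_to (s := Finset.univ) (t := Finset.univ)
    (g := fun α : ∀ i, κ i => α j) fun _ _ => Finset.mem_univ _]
  refine Finset.sum_congr rfl fun k _ => ?_
  -- The fibre is a box with `j`-th side `{k}`, so the sum of products factors and every factor
  -- except the `j`-th is `1`.
  have hfib : (Finset.univ.filter fun α : ∀ i, κ i => α j = k) =
      Fintype.piFinset (Function.update (fun i => (Finset.univ : Finset (κ i))) j {k}) := by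
    ext α
    simp only [Finset.mem_filter, Finset.mem_univ, true_and, Fintype.mem_piFinset]
    constructor
    · intro h i
      by_cases hij : i = j
      · subst hij; simp [h]
      · simp [hij]
    · intro h
      simpa using h j
  have hsum : ∑ α : ∀ i, κ i with α j = k, ∏ i, p i (α i) = p j k := by
    rw [hfib, ← Finset.prod_univ_sum, Finset.prod_eq_single j]
    · simp
    · intro i _ hij
      simp [hij, hp]
    · simp
  rw [← hsum, Finset.sum_smul]
  refine Finset.sum_congr rfl fun α hα => ?_
  rw [(Finset.mem_filter.1 hα).2]

lemma sum_prod_eq_one {ι : Type*} {κ : ι → Type*} [Fintype ι] [DecidableEq ι]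
    [∀ i, Fintype (κ i)] (p : ∀ i, κ i → ℝ≥0) (hp : ∀ i, ∑ k, p i k = 1) :
    ∑ α : ∀ i, κ i, ∏ i, p i (α i) = 1 := by
  rw [← Fintype.prod_sum]
  simp [hp]

/-- A linear programme over mixture weights with prescribed mixtures has a solution. -/
lemma exists_optimal_weights {ι A E : Type*} [MeasurableSpace E] [Fintype A] (c : A → ℝ≥0)
    (m : ι → A → Measure E) (hm : ∀ j α, IsFiniteMeasure (m j α)) (μ : ι → Measure E)
    (hne : ∃ q : A → ℝ≥0, ∑ α, q α = 1 ∧ ∀ j, ∑ α, q α • m j α = μ j) :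
    ∃ q : A → ℝ≥0, (∑ α, q α = 1 ∧ ∀ j, ∑ α, q α • m j α = μ j) ∧
      ∀ q' : A → ℝ≥0, (∑ α, q' α = 1 ∧ ∀ j, ∑ α, q' α • m j α = μ j) →
        ∑ α, q α * c α ≤ ∑ α, q' α * c α := by
  let K : Set (A → ℝ≥0) := {q | ∑ α, q α = 1 ∧ ∀ j, ∑ α, q α • m j α = μ j}
  -- Tested on one measurable set, the equality of measures is an equation continuous in `q`, since
  -- the masses are finite. Hence `K` is closed.
  have hK : K = {q | ∑ α, q α = 1} ∩ ⋂ (j) (s) (_ : MeasurableSet s),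
      {q | ∑ α, (q α : ℝ≥0∞) * m j α s = μ j s} := by
    ext q
    simp only [K, Set.mem_inter_iff, Set.mem_iInter, Set.mem_ofPred_eq, Measure.ext_iff,
      Measure.finsetSum_apply, Measure.smul_apply, ENNReal.smul_def, smul_eq_mul]
  have hclosed : IsClosed K := by
    rw [hK]
    refine (isClosed_eq (by fun_prop) (by fun_prop)).inter (isClosed_iInter fun j =>
      isClosed_iInter fun s => isClosed_iInter fun _ => isClosed_eq ?_ continuous_const)
    refine continuous_finsetSum _ fun α _ => ?_
    exact (ENNReal.continuous_mul_const (measure_ne_top (m j α) s)).comp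
      (ENNReal.continuous_coe.comp (continuous_apply α))
  have hcompact : IsCompact K := by
    refine IsCompact.of_isClosed_subset
      (isCompact_univ_pi fun _ : A => isCompact_Icc (a := (0 : ℝ≥0)) (b := 1)) hclosed ?_
    rintro q ⟨hq, -⟩ α -
    exact ⟨zero_le, hq ▸ Finset.single_le_sum (f := q) (fun _ _ => zero_le)
      (Finset.mem_univ α)⟩
  obtain ⟨q, hq, hmin⟩ := hcompact.exists_isMinOn hne
    (f := fun q : A → ℝ≥0 => ∑ α, q α * c α) (by fun_prop)
  exact ⟨q, hq, fun q' hq' => hmin hq'⟩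

/-! ### Existence of an optimal multi-marginal plan -/

section Existence

variable {d J : ℕ}

/-- The restricted multi-marginal problem has a solution of finite cost. -/
lemma exists_optimal_multiPlan (w : Fin J → ℝ≥0)
    (μ : Fin J → Measure (Eucl d)) (hμ : ∀ j, μ j ∈ gmm (Eucl d)) :
    ∃ γ, IsOptimalMultiPlan w μ γ ∧ planCost w γ ≠ ∞ := by
  classical
  choose κ hκ p g hp _ hg hμeq using fun j => exists_pos_weights_of_mem_gmm (hμ j)
  choose G hG hGmarg hGfin hGmin using fun α : ∀ j, κ j =>
    exists_optimal_gaussian_coupling w (fun j => g j (α j)) fun j => hg j (α j)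
  let c : (∀ j, κ j) → ℝ≥0 := fun α => (planCost w (G α)).toNNReal
  have hc : ∀ α, (c α : ℝ≥0∞) = planCost w (G α) := fun α => ENNReal.coe_toNNReal (hGfin α)
  have hcost : ∀ q : (∀ j, κ j) → ℝ≥0,
      planCost w (∑ α, q α • G α) = ((∑ α, q α * c α : ℝ≥0) : ℝ≥0∞) := by
    intro q
    rw [planCost, lintegral_sum_smul]
    push_cast
    exact Finset.sum_congr rfl fun α _ => by rw [hc]; rfl
  have hmarg : ∀ (q : (∀ j, κ j) → ℝ≥0) (j : Fin J),
      (∑ α, q α • G α).map (fun x => x j) = ∑ α, q α • g j (α j) := by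
    intro q j
    rw [map_sum_smul _ _ (by fun_prop)]
    simp_rw [hGmarg]
  -- Product weights, corresponding to independent choices of components, show feasibility.
  obtain ⟨q, ⟨hq1, hqμ⟩, hqmin⟩ := exists_optimal_weights c (fun j α => g j (α j))
    (fun j α => have := hg j (α j); inferInstance) μ
    ⟨fun α => ∏ j, p j (α j), sum_prod_eq_one p hp, fun j => by
      rw [sum_prod_smul_apply p hp j (g j), ← hμeq]⟩
  have hmem : ∑ α, q α • G α ∈ gmm (Fin J → Eucl d) := sum_smul_mem_gmm q G hq1 hG
  refine ⟨∑ α, q α • G α, ⟨⟨⟨isProbabilityMeasure_of_mem_gmm hmem, fun j => ?_⟩, hmem⟩, ?_⟩, ?_⟩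
  · rw [hmarg, hqμ]
  · rintro γ ⟨⟨-, hγμ⟩, hγ⟩
    obtain ⟨τ, _, r, h, hr, hrpos, hh, rfl⟩ := exists_pos_weights_of_mem_gmm hγ
    -- The `j`-th marginals of the components of a competitor form a representation of `μ j`, so by
    -- identifiability each is one of the `g j i`. Positivity of `r k` is essential: a component of
    -- weight zero is arbitrary.
    have hcomp : ∀ k j, ∃ i, g j i = (h k).map fun x => x j := by
      intro k j
      have hgauss : ∀ k, IsGaussian ((h k).map fun x => x j) := fun k =>
        (inferInstance : IsGaussian ((h k).map
          (ContinuousLinearMap.proj j : (Fin J → Eucl d) →L[ℝ] Eucl d)))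
      refine exists_component_eq_of_mixture_eq r (p j) (fun k => (h k).map fun x => x j) (g j)
        hgauss (hg j) ?_ k (hrpos k)
      rw [← map_sum_smul _ _ (by fun_prop), hγμ, ← hμeq]
    choose α hα using hcomp
    -- Weights of competitor components that couple the same tuple are pooled. This gives a feasible
    -- point of the linear programme costing no more than the competitor.
    let q' : (∀ j, κ j) → ℝ≥0 := fun β => ∑ k with α k = β, r k
    have hq'sum : ∀ {M : Type} [AddCommMonoid M] [Module ℝ≥0 M] (f : (∀ j, κ j) → M),
        ∑ β, q' β • f β = ∑ k, r k • f (α k) := by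
      intro M _ _ f
      rw [← Finset.sum_fiberwise_of_maps_to (s := Finset.univ) (t := Finset.univ)
        (g := α) fun _ _ => Finset.mem_univ _]
      refine Finset.sum_congr rfl fun β _ => ?_
      rw [Finset.sum_smul]
      refine Finset.sum_congr rfl fun k hk => ?_
      rw [(Finset.mem_filter.1 hk).2]
    have hfeas : ∑ β, q' β = 1 ∧ ∀ j, ∑ β, q' β • g j (β j) = μ j := by
      refine ⟨?_, fun j => ?_⟩
      · simpa [hr] using hq'sum fun _ => (1 : ℝ≥0)
      · rw [hq'sum fun β => g j (β j), ← hγμ j, map_sum_smul _ _ (by fun_prop)]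
        simp_rw [hα]
    change planCost w _ ≤ planCost w _
    calc planCost w (∑ α, q α • G α) = ((∑ α, q α * c α : ℝ≥0) : ℝ≥0∞) := hcost q
      _ ≤ ((∑ α, q' α * c α : ℝ≥0) : ℝ≥0∞) := by exact_mod_cast hqmin q' hfeas
      _ = ((∑ k, r k * c (α k) : ℝ≥0) : ℝ≥0∞) := by
          congr 1
          exact hq'sum c
      _ = ∑ k, (r k : ℝ≥0∞) * planCost w (G (α k)) := by
          push_cast
          exact Finset.sum_congr rfl fun k _ => by rw [hc]
      _ ≤ ∑ k, (r k : ℝ≥0∞) * planCost w (h k) := by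
          gcongr with k
          exact hGmin _ _ (hh k) fun j => (hα k j).symm
      _ = planCost w (∑ k, r k • h k) := by
          rw [planCost, lintegral_sum_smul]
          rfl
  · rw [hcost]
    exact ENNReal.coe_ne_top

end Existence

/-! ### Gluing of mixtures and barycenters -/

section Gluing

variable {d J : ℕ}

/-- Gluing of mixture plans whose components all have the same second marginal. -/
lemma exists_gmm_gluing_of_components {κ : Fin J → Type*} [∀ j, Fintype (κ j)]
    (p : ∀ j, κ j → ℝ≥0) (hp : ∀ j, ∑ k, p j k = 1)
    (h : ∀ j, κ j → Measure (Eucl d × Eucl d)) (hh : ∀ j k, IsGaussian (h j k))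
    (n : Measure (Eucl d)) (hn : IsGaussian n) (hsnd : ∀ j k, (h j k).map Prod.snd = n) :
    ∃ γ ∈ gmm ((Fin J → Eucl d) × Eucl d),
      ∀ j, γ.map (fun z => (z.1 j, z.2)) = ∑ k, p j k • h j k := by
  -- One component of each plan is chosen independently, and the chosen Gaussians are glued along
  -- `n`.
  choose G hG hGmarg using fun α : ∀ j, κ j => exists_isGaussian_gluing (fun j => h j (α j))
    (fun j => hh j (α j)) n hn fun j => hsnd j (α j)
  refine ⟨∑ α, (∏ j, p j (α j)) • G α, sum_smul_mem_gmm _ _ (sum_prod_eq_one p hp) hG,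
    fun j => ?_⟩
  rw [map_sum_smul _ _ (by fun_prop)]
  simp_rw [hGmarg]
  exact sum_prod_smul_apply p hp j (h j)

/-- Gluing of Gaussian mixture plans along a common second marginal. -/
lemma exists_gmm_gluing (ν : Measure (Eucl d)) (hν : ν ∈ gmm (Eucl d))
    (γ : Fin J → Measure (Eucl d × Eucl d)) (hγ : ∀ j, γ j ∈ gmm (Eucl d × Eucl d))
    (hsnd : ∀ j, (γ j).map Prod.snd = ν) :
    ∃ Γ ∈ gmm ((Fin J → Eucl d) × Eucl d), ∀ j, Γ.map (fun z => (z.1 j, z.2)) = γ j := by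
  classical
  obtain ⟨ι, _, q, n, hq, hqpos, hn, hνeq⟩ := exists_pos_weights_of_mem_gmm hν
  choose κ _ p h hp hppos hh hγeq using fun j => exists_pos_weights_of_mem_gmm (hγ j)
  have hgauss : ∀ j k, IsGaussian ((h j k).map Prod.snd) := fun j k =>
    have := hh j k
    (inferInstance : IsGaussian ((h j k).map (ContinuousLinearMap.snd ℝ (Eucl d) (Eucl d))))
  have hmix : ∀ j, ∑ k, p j k • (h j k).map Prod.snd = ∑ l, q l • n l := fun j => by
    rw [← map_sum_smul _ _ measurable_snd, ← hγeq, hsnd, hνeq]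
  let S : Finset (Measure (Eucl d)) := Finset.univ.image n
  have hmem : ∀ j k, (h j k).map Prod.snd ∈ S := fun j k => by
    obtain ⟨l, hl⟩ := exists_component_eq_of_mixture_eq (p j) q (fun k => (h j k).map Prod.snd) n
      (hgauss j) hn (hmix j) k (hppos j k)
    exact Finset.mem_image.2 ⟨l, Finset.mem_univ _, hl⟩
  -- `Q s` is the total weight of `s` in `ν`. By identifiability, in every plan the components lying
  -- over `s` have this same total weight.
  let Q : Measure (Eucl d) → ℝ≥0 := fun s => ∑ l with n l = s, q l
  have hQp : ∀ j s, ∑ k with (h j k).map Prod.snd = s, p j k = Q s := fun j s =>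
    sum_weights_eq_of_mixture_eq (p j) q (fun k => (h j k).map Prod.snd) n (hgauss j) hn (hmix j) s
  have hQ0 : ∀ s ∈ S, Q s ≠ 0 := by
    intro s hs h0
    obtain ⟨l, -, rfl⟩ := Finset.mem_image.1 hs
    exact (hqpos l).ne' (Finset.sum_eq_zero_iff.1 h0 l (by simp))
  have hQsum : ∑ s : S, Q s = 1 := by
    rw [Finset.sum_coe_sort S Q, ← hq]
    exact Finset.sum_fiberwise_of_maps_to (fun l _ => Finset.mem_image_of_mem n (Finset.mem_univ l)) q
  have hsub : ∀ {M : Type} [AddCommMonoid M] (j : Fin J) (s : Measure (Eucl d)) (f : κ j → M),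
      ∑ k : {k // (h j k).map Prod.snd = s}, f k =
        ∑ k with (h j k).map Prod.snd = s, f k := fun j s f =>
    (Finset.sum_subtype _ (by simp) f).symm
  -- Conditionally on the component `s` of `ν`, the normalized parts of the plans over `s` share the
  -- second marginal `s` and can be glued. Averaging with the weights `Q s` restores the plans.
  have hloc : ∀ s : S, ∃ Γ ∈ gmm ((Fin J → Eucl d) × Eucl d), ∀ j,
      Γ.map (fun z => (z.1 j, z.2)) =
        ∑ k : {k // (h j k).map Prod.snd = s}, (p j k / Q s) • h j k := by
    intro s
    refine exists_gmm_gluing_of_components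
      (κ := fun j => {k // (h j k).map Prod.snd = s}) (fun j k => p j k / Q s) (fun j => ?_)
      (fun j k => h j k) (fun j k => hh j k) s ?_ fun j k => k.2
    · rw [← Finset.sum_div, hsub j s (p j), hQp, div_self (hQ0 s s.2)]
    · obtain ⟨l, -, hl⟩ := Finset.mem_image.1 s.2
      exact hl ▸ hn l
  choose Γ hΓ hΓmarg using hloc
  refine ⟨∑ s : S, Q s • Γ s, sum_smul_mem_gmm_of_mem_gmm _ _ hQsum hΓ, fun j => ?_⟩
  rw [map_sum_smul _ _ (by fun_prop)]
  simp_rw [hΓmarg, Finset.smul_sum, smul_smul]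
  have hcancel : ∀ (s : S) (k : κ j), Q s * (p j k / Q s) = p j k := fun s k =>
    mul_div_cancel₀ _ (hQ0 s s.2)
  simp_rw [hcancel]
  conv_rhs => rw [hγeq j]
  simp_rw [hsub j _ fun k => p j k • h j k]
  rw [Finset.sum_coe_sort S fun s => ∑ k with (h j k).map Prod.snd = s, p j k • h j k]
  exact Finset.sum_fiberwise_of_maps_to (fun k _ => hmem j k) _

end Gluing

/-! ### Comparison of the barycenter functional with the multi-marginal cost -/

section Barycenter

variable {d J : ℕ}

open scoped RealInnerProductSpace

/-- The weighted mean minimizes the weighted sum of squared distances. -/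
lemma multiCost_le (w : Fin J → ℝ≥0) (hw : ∑ j, w j = 1) (x : Fin J → Eucl d) (y : Eucl d) :
    multiCost w x ≤ ∑ j, (w j : ℝ) * ‖x j - y‖ ^ 2 := by
  have hw' : ∑ j, (w j : ℝ) = 1 := by exact_mod_cast hw
  -- Expansion around `B x`; the cross terms cancel on summation because the weighted deviations
  -- from `B x` add up to zero.
  have hexp : ∀ j, (w j : ℝ) * ‖x j - y‖ ^ 2 = (w j : ℝ) * ‖x j - baryMap w x‖ ^ 2 +
      2 * ⟪(w j : ℝ) • (x j - baryMap w x), baryMap w x - y⟫ +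
        (w j : ℝ) * ‖baryMap w x - y‖ ^ 2 := by
    intro j
    rw [← sub_add_sub_cancel (x j) (baryMap w x) y, norm_add_sq_real, real_inner_smul_left]
    ring
  have hzero : ∑ j, (w j : ℝ) • (x j - baryMap w x) = 0 := by
    simp_rw [smul_sub, Finset.sum_sub_distrib, ← Finset.sum_smul, hw', one_smul]
    exact sub_self _
  simp_rw [hexp, Finset.sum_add_distrib, ← Finset.mul_sum, ← sum_inner, hzero, ← Finset.sum_mul,
    hw']
  simp only [inner_zero_left, mul_zero, add_zero, one_mul]
  exact le_add_of_nonneg_right (sq_nonneg _)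

/-- The barycenter map as a continuous linear map. -/
def baryCLM (w : Fin J → ℝ≥0) : (Fin J → Eucl d) →L[ℝ] Eucl d :=
  ∑ j, (w j : ℝ) • ContinuousLinearMap.proj j

lemma coe_baryCLM (w : Fin J → ℝ≥0) : ⇑(baryCLM (d := d) w) = baryMap w := by
  ext x
  simp [baryCLM, baryMap]

/-- The independent coupling shows that mixture plans exist. -/
lemma exists_gmm_plan (μ ν : Measure (Eucl d)) (hμ : μ ∈ gmm (Eucl d)) (hν : ν ∈ gmm (Eucl d)) :
    (plans μ ν ∩ gmm (Eucl d × Eucl d)).Nonempty := by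
  -- Only admissibility of the two-marginal plan matters, so the cost weights are taken to be zero.
  obtain ⟨γ, ⟨⟨⟨_, hmarg⟩, hγ⟩, -⟩, -⟩ := exists_optimal_multiPlan (fun _ : Fin 2 => 0) ![μ, ν]
    fun j => by fin_cases j <;> simpa
  have hmem := map_mem_gmm hγ ((ContinuousLinearMap.proj 0).prod (ContinuousLinearMap.proj 1) :
    (Fin 2 → Eucl d) →L[ℝ] Eucl d × Eucl d)
  refine ⟨_, ⟨isProbabilityMeasure_of_mem_gmm hmem, ?_, ?_⟩, hmem⟩
  · rw [Measure.map_map (by fun_prop) (by fun_prop)]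
    exact hmarg 0
  · rw [Measure.map_map (by fun_prop) (by fun_prop)]
    exact hmarg 1

lemma lintegral_weighted_sum {X : Type*} [MeasurableSpace X] (m : Measure X) (w : Fin J → ℝ≥0)
    (f : Fin J → X → ℝ) (hf : ∀ j, Measurable (f j)) (hf0 : ∀ j x, 0 ≤ f j x) :
    ∫⁻ x, ENNReal.ofReal (∑ j, (w j : ℝ) * f j x) ∂m =
      ∑ j, (w j : ℝ≥0∞) * ∫⁻ x, ENNReal.ofReal (f j x) ∂m := by
  have : ∀ x, ENNReal.ofReal (∑ j, (w j : ℝ) * f j x) =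
      ∑ j, (w j : ℝ≥0∞) * ENNReal.ofReal (f j x) := fun x => by
    rw [ENNReal.ofReal_sum_of_nonneg fun j _ => mul_nonneg (NNReal.coe_nonneg _) (hf0 j x)]
    simp_rw [ENNReal.ofReal_mul (NNReal.coe_nonneg _), ENNReal.ofReal_coe_nnreal]
  simp_rw [this]
  rw [lintegral_finsetSum _ fun j _ => (hf j).ennreal_ofReal.const_mul _]
  simp_rw [lintegral_const_mul _ (hf _).ennreal_ofReal]

/-- The barycenter of a plan is at most as expensive as the plan. -/
lemma baryObjective_map_baryMap_le (w : Fin J → ℝ≥0) (μ : Fin J → Measure (Eucl d))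
    (γ : Measure (Fin J → Eucl d)) (hγ : γ ∈ gmmMultiPlans μ) :
    baryObjective w μ (γ.map (baryMap w)) ≤ planCost w γ := by
  obtain ⟨⟨_, hmarg⟩, hgmm⟩ := hγ
  have hB := continuous_baryMap (d := d) w
  rw [planCost]
  unfold multiCost
  rw [lintegral_weighted_sum γ w (fun j x => ‖x j - baryMap w x‖ ^ 2)
    (fun j => by fun_prop) fun j x => by positivity]
  refine Finset.sum_le_sum fun j _ => ?_
  gcongr
  let A : (Fin J → Eucl d) →L[ℝ] Eucl d × Eucl d := (ContinuousLinearMap.proj j).prod (baryCLM w)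
  have hA : ⇑A = fun x => (x j, baryMap w x) := by
    ext x <;> simp [A, coe_baryCLM]
  have hmem := map_mem_gmm hgmm A
  have hplan : γ.map A ∈ plans (μ j) (γ.map (baryMap w)) ∩ gmm (Eucl d × Eucl d) := by
    refine ⟨⟨isProbabilityMeasure_of_mem_gmm hmem, ?_, ?_⟩, hmem⟩
    · rw [hA, Measure.map_map (by fun_prop) (by fun_prop)]
      exact hmarg j
    · rw [hA, Measure.map_map (by fun_prop) (by fun_prop)]
      rfl
  refine (iInf₂_le (γ.map A) hplan).trans_eq ?_
  rw [hA, lintegral_map (by fun_prop) (by fun_prop)]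

/-- Plans to a common target can be glued to a multi-marginal plan that is not more expensive. -/
lemma MMW2sq_le_sum_plans (w : Fin J → ℝ≥0) (hw : ∑ j, w j = 1) (μ : Fin J → Measure (Eucl d))
    (ν : Measure (Eucl d)) (hν : ν ∈ gmm (Eucl d)) (γ : Fin J → Measure (Eucl d × Eucl d))
    (hγ : ∀ j, γ j ∈ plans (μ j) ν ∩ gmm (Eucl d × Eucl d)) :
    MMW2sq w μ ≤ ∑ j, (w j : ℝ≥0∞) * ∫⁻ y, ENNReal.ofReal (‖y.1 - y.2‖ ^ 2) ∂(γ j) := by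
  obtain ⟨Γ, hΓ, hΓmarg⟩ := exists_gmm_gluing ν hν γ (fun j => (hγ j).2) fun j => (hγ j).1.2.2
  have hmem : Γ.map Prod.fst ∈ gmm (Fin J → Eucl d) :=
    map_mem_gmm hΓ (ContinuousLinearMap.fst ℝ (Fin J → Eucl d) (Eucl d))
  have hplan : Γ.map Prod.fst ∈ gmmMultiPlans μ := by
    refine ⟨⟨isProbabilityMeasure_of_mem_gmm hmem, fun j => ?_⟩, hmem⟩
    rw [← (hγ j).1.2.1, ← hΓmarg j, Measure.map_map (by fun_prop) (by fun_prop),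
      Measure.map_map (by fun_prop) (by fun_prop)]
    rfl
  refine (iInf₂_le _ hplan).trans ?_
  rw [planCost, lintegral_map (continuous_multiCost w).measurable.ennreal_ofReal (by fun_prop)]
  calc ∫⁻ z, ENNReal.ofReal (multiCost w z.1) ∂Γ
      ≤ ∫⁻ z, ENNReal.ofReal (∑ j, (w j : ℝ) * ‖z.1 j - z.2‖ ^ 2) ∂Γ :=
        lintegral_mono fun z => ENNReal.ofReal_le_ofReal (multiCost_le w hw z.1 z.2)
    _ = ∑ j, (w j : ℝ≥0∞) * ∫⁻ z, ENNReal.ofReal (‖z.1 j - z.2‖ ^ 2) ∂Γ :=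
        lintegral_weighted_sum Γ w (fun j z => ‖z.1 j - z.2‖ ^ 2) (fun j => by fun_prop)
          fun j z => by positivity
    _ = _ := by
        refine Finset.sum_congr rfl fun j _ => ?_
        rw [← hΓmarg j, lintegral_map (by fun_prop) (by fun_prop)]

/-- The multi-marginal value is a lower bound for the barycenter problem. -/
lemma MMW2sq_le_baryObjective (w : Fin J → ℝ≥0) (hw : ∑ j, w j = 1)
    (μ : Fin J → Measure (Eucl d)) (hμ : ∀ j, μ j ∈ gmm (Eucl d))
    (ν : Measure (Eucl d)) (hν : ν ∈ gmm (Eucl d)) : MMW2sq w μ ≤ baryObjective w μ ν := by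
  -- Attainment in `MW2sq` is not needed: `ε`-optimal plans suffice, and since the weights sum to
  -- `1` the total error is `ε`.
  refine ENNReal.le_of_forall_pos_le_add fun ε hε _ => ?_
  have hex : ∀ j, ∃ γ ∈ plans (μ j) ν ∩ gmm (Eucl d × Eucl d),
      ∫⁻ y, ENNReal.ofReal (‖y.1 - y.2‖ ^ 2) ∂γ ≤ MW2sq (μ j) ν + ε := by
    intro j
    by_cases htop : MW2sq (μ j) ν = ∞
    · obtain ⟨γ, hγ⟩ := exists_gmm_plan (μ j) ν (hμ j) hν
      exact ⟨γ, hγ, by simp [htop]⟩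
    · have hlt : MW2sq (μ j) ν < MW2sq (μ j) ν + ε :=
        ENNReal.lt_add_right htop (by exact_mod_cast hε.ne')
      conv_lhs at hlt => rw [MW2sq]
      simp only [iInf_lt_iff] at hlt
      obtain ⟨γ, hγ, hlt⟩ := hlt
      exact ⟨γ, hγ, hlt.le⟩
  choose γ hγ hcost using hex
  calc MMW2sq w μ ≤ ∑ j, (w j : ℝ≥0∞) * ∫⁻ y, ENNReal.ofReal (‖y.1 - y.2‖ ^ 2) ∂(γ j) :=
        MMW2sq_le_sum_plans w hw μ ν hν γ hγ
    _ ≤ ∑ j, (w j : ℝ≥0∞) * (MW2sq (μ j) ν + ε) := by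
        gcongr with j
        exact hcost j
    _ = baryObjective w μ ν + ε := by
        simp_rw [mul_add, Finset.sum_add_distrib, ← Finset.sum_mul]
        rw [show ∑ j, (w j : ℝ≥0∞) = 1 by exact_mod_cast hw, one_mul]
        rfl

lemma MMW2sq_eq_planCost {w : Fin J → ℝ≥0} {μ : Fin J → Measure (Eucl d)}
    {γ : Measure (Fin J → Eucl d)} (hγ : IsOptimalMultiPlan w μ γ) :
    MMW2sq w μ = planCost w γ :=
  le_antisymm (iInf₂_le γ hγ.1) (le_iInf₂ fun _ h => hγ.2 h)

end Barycenter

end GMMOT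

end

theorem mainTheorem5 {d J : ℕ} (w : Fin J → ℝ≥0) (hw : ∑ j, w j = 1)
    (μ : Fin J → Measure (GMMOT.Eucl d)) (hμ : ∀ j, μ j ∈ GMMOT.gmm (GMMOT.Eucl d)) :
    (∃ γ, GMMOT.IsOptimalMultiPlan w μ γ) ∧
    (∀ γ, GMMOT.IsOptimalMultiPlan w μ γ →
      GMMOT.IsMW2Barycenter w μ (γ.map (GMMOT.baryMap w))) ∧
    (⨅ ν ∈ GMMOT.gmm (GMMOT.Eucl d), GMMOT.baryObjective w μ ν) = GMMOT.MMW2sq w μ ∧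
    GMMOT.MMW2sq w μ ≠ ∞ := by
  have hgmm : ∀ γ, GMMOT.IsOptimalMultiPlan w μ γ →
      γ.map (GMMOT.baryMap w) ∈ GMMOT.gmm (GMMOT.Eucl d) := fun γ hγ =>
    GMMOT.coe_baryCLM (d := d) w ▸ GMMOT.map_mem_gmm hγ.1.2 (GMMOT.baryCLM w)
  have hle : ∀ γ, GMMOT.IsOptimalMultiPlan w μ γ →
      GMMOT.baryObjective w μ (γ.map (GMMOT.baryMap w)) ≤ GMMOT.MMW2sq w μ := fun γ hγ =>
    (GMMOT.baryObjective_map_baryMap_le w μ γ hγ.1).trans_eq (GMMOT.MMW2sq_eq_planCost hγ).symm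
  obtain ⟨γ, hγ, hfin⟩ := GMMOT.exists_optimal_multiPlan w μ hμ
  refine ⟨⟨γ, hγ⟩, fun γ' hγ' => ⟨hgmm γ' hγ', fun ν hν =>
    (hle γ' hγ').trans (GMMOT.MMW2sq_le_baryObjective w hw μ hμ ν hν)⟩,
    le_antisymm ((iInf₂_le _ (hgmm γ hγ)).trans (hle γ hγ))
      (le_iInf₂ fun ν hν => GMMOT.MMW2sq_le_baryObjective w hw μ hμ ν hν), ?_⟩
  rw [GMMOT.MMW2sq_eq_planCost hγ]
  exact hfin
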